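/- Let $K=\mathbb{Q}(\sqrt5)$, let $'$ be its non-trivial automorphism ($\sqrt5\mapsto-\sqrt5$), let $\tau=(1+\sqrt5)/2$ and $\mathfrak{o}=\mathbb{Z}[\tau]$. Write quaternions in $\mathbb{H}(K)\subset\mathbb{H}(\mathbb{R})=\mathbb{R}^4$ as $(a,b,c,d)=a+\mathrm{i}b+\mathrm{j}c+\mathrm{k}d$, let $|q|$ be the Euclidean length of $q$, and for $q=(a,b,c,d)\in\mathbb{H}(K)$ let $\tilde q=(a',b',d',c')$. Let $\mathbb{I}\subset\mathbb{H}(K)$ be the icosian ring, the $\mathfrak{o}$-span of $(1,0,0,0)$, $(0,1,0,0)$, $\tfrac12(1,1,1,1)$, $\tfrac12(1-\tau,\tau,0,1)$, and let $L\subset\mathbb{R}^4$ be the lattice (a copy of the root lattice $A_4$ scaled by $1/\sqrt2$) spanned over $\mathbb{Z}$ by $(1,0,0,0)$, $\tfrac12(-1,1,1,1)$, $(0,-1,0,0)$, $\tfrac12(0,1,\tau-1,-\tau)$. An icosian $p\in\mathbb{I}$ is called primitive if $\alpha p\in\mathbb{I}$ with $\alpha\in K$ implies $\alpha\in\mathfrak{o}$,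 and admissible if $|p\tilde p|\in\mathbb{N}$. For $a,b\in\mathbb{I}$, let $\operatorname{glcd}(a,b)$ be their greatest left common divisor in $\mathbb{I}$, that is, an element $d\in\mathbb{I}$ with $a,b\in d\mathbb{I}$ such that $d\in c\mathbb{I}$ for every $c\in\mathbb{I}$ with $a,b\in c\mathbb{I}$; it is determined up to right multiplication by units of $\mathbb{I}$, and equality of greatest left common divisors is understood in this sense. Let $p_1,p_2\in\mathbb{I}$ be primitive and admissible, such that $$|p_1|^2=|p_2|^2\quad\text{and}\quad \operatorname{glcd}(p_1,|p_1\tilde p_1|)=\operatorname{glcd}(p_2,|p_2\tilde p_2|).$$ Then $p_1$ and $p_2$ define the same coincidence site lattice of $L$: $$L\cap\frac{1}{|p_1\tilde p_1|}\,p_1L\tilde p_1 \;=\; L\cap\frac{1}{|p_2\tilde p_2|}\,p_2L\tilde p_2 .$$ -/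

import Mathlib

open scoped Quaternion

noncomputable section

namespace Icosian

/-- The quadratic field `ℚ(√5)`, with elements `r + s √5` for rational `r`, `s`. -/
abbrev K : Type := QuadraticAlgebra ℚ 5 0

/-- The golden ratio `(1 + √5) / 2` as an element of `ℚ(√5)`. -/
def τ : K := ⟨1 / 2, 1 / 2⟩

theorem τ_mul_τ : τ * τ = τ + 1 := by
  ext <;> simp [τ, QuadraticAlgebra.re_one, QuadraticAlgebra.im_one] <;> norm_num

/-- The algebraic conjugation `r + s √5 ↦ r - s √5` of `ℚ(√5)`. -/
def conj (α : K) : K := ⟨α.re, -α.im⟩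

/-- The real embedding of `ℚ(√5)` that sends `√5` to the positive square root of `5`. -/
def toReal : K →ₐ[ℚ] ℝ :=
  QuadraticAlgebra.lift ⟨√5, by
    rw [Real.mul_self_sqrt (by norm_num)]
    simp [Algebra.smul_def]⟩

/-- The ring `ℤ[τ] = {m + n τ | m, n ∈ ℤ}`. -/
def 𝔬 : Subring K where
  carrier := {α | ∃ m n : ℤ, α = m + n * τ}
  zero_mem' := ⟨0, 0, by simp⟩
  one_mem' := ⟨1, 0, by simp⟩
  add_mem' := by
    rintro _ _ ⟨m, n, rfl⟩ ⟨m', n', rfl⟩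
    exact ⟨m + m', n + n', by push_cast; ring⟩
  neg_mem' := by
    rintro _ ⟨m, n, rfl⟩
    exact ⟨-m, -n, by push_cast; ring⟩
  mul_mem' := by
    rintro _ _ ⟨m, n, rfl⟩ ⟨m', n', rfl⟩
    refine ⟨m * m' + n * n', m * n' + n * m' + n * n', ?_⟩
    push_cast
    linear_combination (n * n' : K) * τ_mul_τ

/-- The icosian ring: all `𝔬`-linear combinations of `(1,0,0,0)`, `(0,1,0,0)`,
`½(1,1,1,1)` and `½(1-τ,τ,0,1)` in the quaternion algebra `ℍ(K)`. -/
def 𝕀 : Submodule 𝔬 ℍ[K] :=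
  Submodule.span 𝔬
    {⟨1, 0, 0, 0⟩, ⟨0, 1, 0, 0⟩,
      (1 / 2 : ℚ) • (⟨1, 1, 1, 1⟩ : ℍ[K]),
      (1 / 2 : ℚ) • (⟨1 - τ, τ, 0, 1⟩ : ℍ[K])}

/-- The twist map `(a, b, c, d) ↦ (a', b', d', c')`. -/
def twist (q : ℍ[K]) : ℍ[K] :=
  ⟨conj q.re, conj q.imI, conj q.imK, conj q.imJ⟩

/-- The inclusion of `ℍ(K)` into the real quaternions, i.e. into Euclidean 4-space. -/
def toRealQuat (q : ℍ[K]) : ℍ[ℝ] :=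
  ⟨toReal q.re, toReal q.imI, toReal q.imJ, toReal q.imK⟩

/-- The Euclidean length `|q|`, a real number that need not lie in `K`. -/
def len (q : ℍ[K]) : ℝ := ‖toRealQuat q‖

/-- `p` is a primitive icosian: `α p ∈ 𝕀` with `α ∈ K` is only possible with `α ∈ 𝔬`. -/
def IsPrimitive (p : ℍ[K]) : Prop :=
  p ∈ 𝕀 ∧ ∀ α : K, α • p ∈ 𝕀 → α ∈ 𝔬

/-- `p` is an admissible icosian: `|p p̃|` is a natural number. -/
def IsAdmissible (p : ℍ[K]) : Prop :=
  p ∈ 𝕀 ∧ ∃ n : ℕ, len (p * twist p) = n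

/-- `d` is a left divisor of `a` in the icosian ring: `a ∈ d 𝕀`. -/
def LeftDvd (d a : ℍ[K]) : Prop :=
  ∃ x ∈ 𝕀, a = d * x

/-- The greatest left common divisors of `a` and `b` in the icosian ring. A greatest left common
divisor is only determined up to right multiplication by units of `𝕀`, so `glcd a b` is the
class of all of them. -/
def glcd (a b : ℍ[K]) : Set ℍ[K] :=
  {d | d ∈ 𝕀 ∧ LeftDvd d a ∧ LeftDvd d b ∧
    ∀ c ∈ 𝕀, LeftDvd c a → LeftDvd c b → LeftDvd c d}

/-- The lattice `L` in Euclidean 4-space (the root lattice `A₄` scaled by `1/√2`): the integer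
span of `(1,0,0,0)`, `½(-1,1,1,1)`, `(0,-1,0,0)` and `½(0,1,τ-1,-τ)`. -/
def L : AddSubgroup ℍ[ℝ] :=
  AddSubgroup.closure
    {⟨1, 0, 0, 0⟩,
      (1 / 2 : ℝ) • (⟨-1, 1, 1, 1⟩ : ℍ[ℝ]),
      ⟨0, -1, 0, 0⟩,
      (1 / 2 : ℝ) • (⟨0, 1, Real.goldenRatio - 1, -Real.goldenRatio⟩ : ℍ[ℝ])}

/-- The map `R(q) : x ↦ |q q̃|⁻¹ q x q̃` of Euclidean 4-space. -/
def R (q : ℍ[K]) : ℍ[ℝ] →ₗ[ℝ] ℍ[ℝ] :=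
  (len (q * twist q))⁻¹ •
    (LinearMap.mulLeft ℝ (toRealQuat q) ∘ₗ LinearMap.mulRight ℝ (toRealQuat (twist q)))

/-- The coincidence site lattice `L ∩ R(q) L` defined by `q`. -/
def csl (q : ℍ[K]) : AddSubgroup ℍ[ℝ] :=
  L ⊓ L.map (R q).toAddMonoidHom

end Icosian

end

/-! `L` is the set of icosians fixed by the twist (`mem_L_iff`), and the twist reverses products.
With `n = |p p̃|`, the map `x ↦ p x p̃ / n` is inverted by the same map for `star p`, because `|p|²
|p̃|² = n²`. Hence `z ∈ L` lies in the coincidence site lattice of `p` iff `n` divides `star p * z *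
twist (star p)` in `𝕀` (`mem_csl_iff`).

Modulo `n`, this condition sees only the right ideal `p𝕀 + n𝕀`. The icosian ring is norm-Euclidean
(`exists_icosian_near`, `exists_bezout`), so any glcd `g` of `p` and `n` generates that ideal, and
`p` may be replaced by `g` (`leftDvd_star_mul_twist_iff`). Since `n² = |p|² (|p|²)'`, equal lengths
give equal `n`. With a common `g` the two conditions then coincide. -/

noncomputable section

namespace Icosian

open Quaternion QuadraticAlgebra

/-! ### Arithmetic of the icosian ring and the twist -/

/-- The golden ratio as an element of `ℤ[τ]`. -/
def τₒ : 𝔬 := ⟨τ, 0, 1, by simp⟩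

/-- The quaternion over `ℚ(√5)` with the given components. -/
def quat (a b c d : K) : ℍ[K] := ⟨a, b, c, d⟩

/-- The icosian with coordinates `a, b, c, d` in the defining basis of `𝕀`. -/
def ofCoords (a b c d : K) : ℍ[K] :=
  quat (a + (1 / 2 : ℚ) • (c + (1 - τ) * d)) (b + (1 / 2 : ℚ) • (c + τ * d))
    ((1 / 2 : ℚ) • c) ((1 / 2 : ℚ) • (c + d))

section components

variable (a b c d : K) (q : ℍ[K]) (α : K)

@[simp]
theorem re_quat : (quat a b c d).re = a := rfl

@[simp]
theorem imI_quat : (quat a b c d).imI = b := rfl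

@[simp]
theorem imJ_quat : (quat a b c d).imJ = c := rfl

@[simp]
theorem imK_quat : (quat a b c d).imK = d := rfl

@[simp]
theorem re_ofCoords : (ofCoords a b c d).re = a + (1 / 2 : ℚ) • (c + (1 - τ) * d) := rfl

@[simp]
theorem imI_ofCoords : (ofCoords a b c d).imI = b + (1 / 2 : ℚ) • (c + τ * d) := rfl

@[simp]
theorem imJ_ofCoords : (ofCoords a b c d).imJ = (1 / 2 : ℚ) • c := rfl

@[simp]
theorem imK_ofCoords : (ofCoords a b c d).imK = (1 / 2 : ℚ) • (c + d) := rfl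

@[simp]
theorem re_conj : (conj α).re = α.re := rfl

@[simp]
theorem im_conj : (conj α).im = -α.im := rfl

@[simp]
theorem re_twist : (twist q).re = conj q.re := rfl

@[simp]
theorem imI_twist : (twist q).imI = conj q.imI := rfl

@[simp]
theorem imJ_twist : (twist q).imJ = conj q.imK := rfl

@[simp]
theorem imK_twist : (twist q).imK = conj q.imJ := rfl

@[simp]
theorem re_τ : τ.re = 1 / 2 := rfl

@[simp]
theorem im_τ : τ.im = 1 / 2 := rfl

@[simp]
theorem coe_τₒ : (τₒ : K) = τ := rfl

end components

theorem mem_icosian_iff {x : ℍ[K]} :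
    x ∈ 𝕀 ↔ ∃ a b c d : 𝔬, x = ofCoords a b c d := by
  change x ∈ Submodule.span 𝔬 {quat 1 0 0 0, quat 0 1 0 0, (1 / 2 : ℚ) • quat 1 1 1 1,
    (1 / 2 : ℚ) • quat (1 - τ) τ 0 1} ↔ _
  simp only [Submodule.mem_span_insert, Submodule.mem_span_singleton]
  constructor
  · rintro ⟨a, _, ⟨b, _, ⟨c, _, ⟨d, rfl⟩, rfl⟩, rfl⟩, rfl⟩
    refine ⟨a, b, c, d, ?_⟩
    ext <;> simp [Subring.smul_def] <;> ring
  · rintro ⟨a, b, c, d, rfl⟩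
    refine ⟨a, _, ⟨b, _, ⟨c, _, ⟨d, rfl⟩, rfl⟩, rfl⟩, ?_⟩
    ext <;> simp [Subring.smul_def] <;> ring

theorem natCast_mem_icosian (n : ℕ) : (n : ℍ[K]) ∈ 𝕀 := by
  refine mem_icosian_iff.2 ⟨n, 0, 0, 0, ?_⟩
  ext <;> simp

theorem one_mem_icosian : (1 : ℍ[K]) ∈ 𝕀 := by
  simpa using natCast_mem_icosian 1

/-- All structure constants lie in `ℤ[τ]`; this is what makes `𝕀` a ring. -/
theorem ofCoords_mul (a b c d a' b' c' d' : K) :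
    ofCoords a b c d * ofCoords a' b' c' d' = ofCoords
      (a * a' - b * b' + (τ - 1) * b * c' - τ * c * b' - c * c' - c * d' - τ * d * b' - d * d')
      (a * b' + b * a' + (1 - τ) * b * c' + (1 - τ) * b * d' + τ * c * b' + c * d' - d * c')
      (a * c' + c * a' - b * c' - b * d' + c * b' + c * c' + d * b' + (1 - τ) * d * c')
      (a * d' + d * a' + 2 * b * c' + b * d' - 2 * c * b' + (1 - τ) * c * d' - d * b'
        + τ * d * c' + (1 - τ) * d * d') := by
  have h := τ_mul_τ
  -- With `η` for `1/2` and `t` for `τ`, only polynomial identities modulo `2η = 1` and `t² = t + 1`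
  -- remain.
  obtain ⟨η, hη⟩ : ∃ η : K, η = algebraMap ℚ K (1 / 2) := ⟨_, rfl⟩
  have h2 : 2 * η = 1 := by rw [hη]; ext <;> simp
  have h3 : ∀ x : K, (1 / 2 : ℚ) • x = η * x := fun x => by rw [hη, Algebra.smul_def]
  generalize hτ : τ = t at *
  ext1 <;> simp only [Quaternion.re_mul, imI_mul, imJ_mul, imK_mul,
    re_ofCoords, imI_ofCoords, imJ_ofCoords, imK_ofCoords, h3, hτ]
  all_goals clear hη h3 hτ
  all_goals grind

theorem mul_mem_icosian {x y : ℍ[K]} (hx : x ∈ 𝕀) (hy : y ∈ 𝕀) : x * y ∈ 𝕀 := by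
  obtain ⟨a, b, c, d, rfl⟩ := mem_icosian_iff.1 hx
  obtain ⟨a', b', c', d', rfl⟩ := mem_icosian_iff.1 hy
  rw [ofCoords_mul]
  exact mem_icosian_iff.2
    ⟨a * a' - b * b' + (τₒ - 1) * b * c' - τₒ * c * b' - c * c' - c * d' - τₒ * d * b' - d * d',
     a * b' + b * a' + (1 - τₒ) * b * c' + (1 - τₒ) * b * d' + τₒ * c * b' + c * d' - d * c',
     a * c' + c * a' - b * c' - b * d' + c * b' + c * c' + d * b' + (1 - τₒ) * d * c',
     a * d' + d * a' + 2 * b * c' + b * d' - 2 * c * b' + (1 - τₒ) * c * d' - d * b'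
      + τₒ * d * c' + (1 - τₒ) * d * d', rfl⟩

theorem star_mem_icosian {x : ℍ[K]} (hx : x ∈ 𝕀) : star x ∈ 𝕀 := by
  obtain ⟨a, b, c, d, rfl⟩ := mem_icosian_iff.1 hx
  refine mem_icosian_iff.2 ⟨a + c + (1 - τₒ) * d, -b, -c, -d, ?_⟩
  ext <;> simp <;> ring

theorem conj_mem {α : K} (h : α ∈ 𝔬) : conj α ∈ 𝔬 := by
  obtain ⟨m, n, rfl⟩ := h
  refine ⟨m + n, -n, ?_⟩
  ext <;> simp
  ring

theorem twist_mem_icosian {x : ℍ[K]} (hx : x ∈ 𝕀) : twist x ∈ 𝕀 := by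
  obtain ⟨a, b, c, d, rfl⟩ := mem_icosian_iff.1 hx
  refine mem_icosian_iff.2 ⟨⟨_, conj_mem a.2⟩, ⟨_, conj_mem b.2⟩,
    ⟨_, conj_mem c.2⟩ + ⟨_, conj_mem d.2⟩, -⟨_, conj_mem d.2⟩, ?_⟩
  ext <;> simp <;> ring

theorem twist_add (x y : ℍ[K]) : twist (x + y) = twist x + twist y := by
  ext <;> simp <;> ring

/-- Swapping `j` and `k` is a reflection of the imaginary space, hence an anti-automorphism;
conjugating the coefficients preserves products. -/
theorem twist_mul (x y : ℍ[K]) : twist (x * y) = twist y * twist x := by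
  ext <;> simp <;> ring

theorem twist_twist (x : ℍ[K]) : twist (twist x) = x := by
  ext <;> simp

theorem twist_star (x : ℍ[K]) : twist (star x) = star (twist x) := by
  ext <;> simp

theorem twist_natCast (n : ℕ) : twist (n : ℍ[K]) = n := by
  ext <;> simp

/-! ### Reduced and absolute norms -/

/-- `x * star x` is an icosian with no `j` or `k` part, so its last two coordinates vanish and its
real part is the first one. -/
theorem normSq_mem {x : ℍ[K]} (hx : x ∈ 𝕀) : normSq x ∈ 𝔬 := by
  obtain ⟨a, b, c, d, h⟩ := mem_icosian_iff.1 (mul_mem_icosian hx (star_mem_icosian hx))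
  rw [self_mul_star] at h
  have hJ := congrArg QuaternionAlgebra.imJ h
  have hK := congrArg QuaternionAlgebra.imK h
  have hre := congrArg QuaternionAlgebra.re h
  simp only [ofCoords, imJ_coe, imK_coe, re_coe] at hJ hK hre
  have hc : (c : K) = 0 := by simpa using hJ.symm
  have hd : (d : K) = 0 := by simpa [hc] using hK.symm
  rw [hre, hc, hd]
  simp

/-- The absolute norm of a quaternion over `ℚ(√5)`: the field norm of the reduced norm. -/
def absNorm (x : ℍ[K]) : ℚ := QuadraticAlgebra.norm (normSq x)

theorem absNorm_mul (x y : ℍ[K]) : absNorm (x * y) = absNorm x * absNorm y := by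
  simp [absNorm]

theorem toReal_apply (α : K) : toReal α = α.re + α.im * √5 := by
  simp [toReal, QuadraticAlgebra.lift, Algebra.smul_def]

theorem toReal_injective : Function.Injective toReal := by
  rw [injective_iff_map_eq_zero]
  intro α h
  rw [toReal_apply] at h
  have h5 : Irrational √5 := by
    have := Nat.Prime.irrational_sqrt (p := 5) (by norm_num)
    simpa using this
  have him : α.im = 0 := by
    by_contra h0
    refine h5 ⟨-α.re / α.im, ?_⟩
    have : (α.im : ℝ) ≠ 0 := by exact_mod_cast h0
    push_cast
    field_simp
    linarith
  have hre : α.re = 0 := by simpa [him] using h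
  ext <;> simp [him, hre]

theorem toReal_norm (α : K) : toReal α * toReal (conj α) = (QuadraticAlgebra.norm α : ℚ) := by
  have h5 : √5 * √5 = (5 : ℝ) := Real.mul_self_sqrt (by norm_num)
  simp only [toReal_apply, conj, QuadraticAlgebra.norm_def]
  push_cast
  linear_combination (-(α.im : ℝ) * α.im) * h5

theorem conj_normSq (x : ℍ[K]) : conj (normSq x) = normSq (twist x) := by
  ext <;> simp [normSq_def', pow_two] <;> ring

theorem toReal_normSq_nonneg (x : ℍ[K]) : 0 ≤ toReal (normSq x) := by
  simp only [normSq_def', map_add, map_pow]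
  positivity

/-- Both real conjugates of `normSq x` are sums of squares. -/
theorem absNorm_nonneg (x : ℍ[K]) : 0 ≤ absNorm x := by
  have h : (0 : ℝ) ≤ absNorm x := by
    rw [absNorm, ← toReal_norm, conj_normSq]
    exact mul_nonneg (toReal_normSq_nonneg _) (toReal_normSq_nonneg _)
  exact_mod_cast h

theorem normSq_eq_zero_iff {x : ℍ[K]} : normSq x = 0 ↔ x = 0 := by
  refine ⟨fun h => ?_, fun h => by simp [h]⟩
  have h1 := congrArg toReal h
  simp only [normSq_def', map_add, map_pow, map_zero] at h1
  have key : ∀ α : K, toReal α ^ 2 = 0 → α = 0 := fun α hα =>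
    toReal_injective (by simpa using hα)
  have e0 := sq_nonneg (toReal x.re)
  have e1 := sq_nonneg (toReal x.imI)
  have e2 := sq_nonneg (toReal x.imJ)
  have e3 := sq_nonneg (toReal x.imK)
  exact QuaternionAlgebra.ext (key _ (by linarith)) (key _ (by linarith)) (key _ (by linarith))
    (key _ (by linarith))

theorem twist_eq_zero_iff {x : ℍ[K]} : twist x = 0 ↔ x = 0 := by
  have h0 : twist 0 = 0 := by simpa using twist_natCast 0
  exact ⟨fun h => by rw [← twist_twist x, h, h0], fun h => by rw [h, h0]⟩

theorem absNorm_eq_zero_iff {x : ℍ[K]} : absNorm x = 0 ↔ x = 0 := by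
  refine ⟨fun h => ?_, fun h => by simp [h, absNorm]⟩
  have h1 := toReal_norm (normSq x)
  rw [conj_normSq, show QuadraticAlgebra.norm (normSq x) = 0 from h, Rat.cast_zero,
    mul_eq_zero, map_eq_zero_iff _ toReal_injective, map_eq_zero_iff _ toReal_injective,
    normSq_eq_zero_iff, normSq_eq_zero_iff, twist_eq_zero_iff, or_self] at h1
  exact h1

theorem exists_absNorm_eq_natCast {x : ℍ[K]} (hx : x ∈ 𝕀) : ∃ k : ℕ, absNorm x = k := by
  obtain ⟨m, n, h⟩ := normSq_mem hx
  have h1 : absNorm x = ((m ^ 2 + m * n - n ^ 2 : ℤ) : ℚ) := by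
    rw [absNorm, h, QuadraticAlgebra.norm_def]
    simp [τ]
    ring
  have h2 : 0 ≤ m ^ 2 + m * n - n ^ 2 := by
    have := absNorm_nonneg x
    rw [h1] at this
    exact_mod_cast this
  refine ⟨(m ^ 2 + m * n - n ^ 2).toNat, ?_⟩
  rw [h1]
  exact_mod_cast (Int.toNat_of_nonneg h2).symm

/-! ### Euclidean division via the Hamming code -/

/-- Each residue class modulo `2` contains an integer near `x`: the distance is at most `1/2` for
the class of `round x` and at most `1` for the other one. -/
theorem exists_int_near (x : ℚ) (e : ZMod 2) :
    ∃ z : ℤ, (z : ZMod 2) = (round x : ZMod 2) + e ∧ (x - z) ^ 2 ≤ 1 / 4 + 3 / 4 * (e.val : ℚ) := by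
  have h := abs_le.1 (abs_sub_round x)
  have he : e = 0 ∨ e = 1 := by revert e; decide
  rcases he with rfl | rfl
  · refine ⟨round x, by simp, ?_⟩
    simp only [ZMod.val_zero]
    push_cast
    nlinarith
  · have hv : ((1 : ZMod 2).val : ℚ) = 1 := by norm_num [ZMod.val_one]
    rw [hv]
    rcases le_total 0 (x - round x) with h0 | h0
    · refine ⟨round x + 1, by push_cast; ring, ?_⟩
      push_cast
      nlinarith
    · refine ⟨round x - 1, ?_, ?_⟩
      · push_cast
        rw [sub_eq_add_neg, show (-1 : ZMod 2) = 1 by decide]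
      · push_cast
        nlinarith

/-- The extended Hamming code of length `8` has covering radius at most `2`. -/
theorem exists_syndrome_eq (s₁ s₂ s₃ s₄ : ZMod 2) :
    ∃ u₀ v₀ u₁ v₁ u₂ v₂ u₃ v₃ : ZMod 2,
      u₀.val + v₀.val + u₁.val + v₁.val + u₂.val + v₂.val + u₃.val + v₃.val ≤ 2 ∧
      u₁ - u₃ - v₃ + v₂ = s₁ ∧ v₁ - v₂ - u₃ + u₂ = s₂ ∧
      u₀ - u₂ + v₃ - v₂ = s₃ ∧ v₀ + u₃ - u₂ - v₃ = s₄ := by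
  revert s₁ s₂ s₃ s₄
  decide

/-- Each component is `(u + v (τ - 1)) / 2`. In this basis `re + im` of its square is `(u² + v²) /
4`, so the form `re + im` of `normSq` is a multiple of the standard one on `ℤ⁸`, and the parity
conditions are the checks of the code. -/
theorem mem_icosian_of_even {u₀ v₀ u₁ v₁ u₂ v₂ u₃ v₃ : ℤ}
    (h₁ : 2 ∣ u₁ - u₃ - v₃ + v₂) (h₂ : 2 ∣ v₁ - v₂ - u₃ + u₂)
    (h₃ : 2 ∣ u₀ - u₂ + v₃ - v₂) (h₄ : 2 ∣ v₀ + u₃ - u₂ - v₃) :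
    quat ⟨u₀ / 2 - v₀ / 4, v₀ / 4⟩ ⟨u₁ / 2 - v₁ / 4, v₁ / 4⟩ ⟨u₂ / 2 - v₂ / 4, v₂ / 4⟩
      ⟨u₃ / 2 - v₃ / 4, v₃ / 4⟩ ∈ 𝕀 := by
  obtain ⟨k₁, h₁⟩ := h₁
  obtain ⟨k₂, h₂⟩ := h₂
  obtain ⟨k₃, h₃⟩ := h₃
  obtain ⟨k₄, h₄⟩ := h₄
  obtain rfl : u₁ = 2 * k₁ + u₃ + v₃ - v₂ := by linarith
  obtain rfl : v₁ = 2 * k₂ + v₂ + u₃ - u₂ := by linarith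
  obtain rfl : u₀ = 2 * k₃ + u₂ - v₃ + v₂ := by linarith
  obtain rfl : v₀ = 2 * k₄ - u₃ + u₂ + v₃ := by linarith
  refine mem_icosian_iff.2 ⟨(k₃ : 𝔬) + k₄ * (τₒ - 1), (k₁ : 𝔬) + k₂ * (τₒ - 1),
    (u₂ : 𝔬) + v₂ * (τₒ - 1), ((u₃ - u₂ : ℤ) : 𝔬) + (v₃ - v₂ : ℤ) * (τₒ - 1), ?_⟩
  ext <;> simp <;> ring

/-- The two sides differ by `(re + 5 im)² / 4`. This bounds the quartic norm by a positive definite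
quadratic form. -/
theorem absNorm_le (x : ℍ[K]) :
    absNorm x ≤ 5 / 4 * ((normSq x).re + (normSq x).im) ^ 2 := by
  rw [absNorm, QuadraticAlgebra.norm_def]
  nlinarith [sq_nonneg ((normSq x).re + 5 * (normSq x).im)]

theorem exists_icosian_near (x : ℍ[K]) : ∃ q ∈ 𝕀, absNorm (x - q) < 1 := by
  set r : K → ℤ := fun α => round (2 * (α.re + α.im))
  set s : K → ℤ := fun α => round (4 * α.im)
  -- Rounding all eight coordinates may violate the parity checks; moving at most two of them to the
  -- other parity class cancels the syndrome.
  obtain ⟨a₀, b₀, a₁, b₁, a₂, b₂, a₃, b₃, hw, e₁, e₂, e₃, e₄⟩ := exists_syndrome_eq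
    (-(r x.imI - r x.imK - s x.imK + s x.imJ)) (-(s x.imI - s x.imJ - r x.imK + r x.imJ))
    (-(r x.re - r x.imJ + s x.imK - s x.imJ)) (-(s x.re + r x.imK - r x.imJ - s x.imK))
  obtain ⟨u₀, hu₀, du₀⟩ := exists_int_near (2 * (x.re.re + x.re.im)) a₀
  obtain ⟨v₀, hv₀, dv₀⟩ := exists_int_near (4 * x.re.im) b₀
  obtain ⟨u₁, hu₁, du₁⟩ := exists_int_near (2 * (x.imI.re + x.imI.im)) a₁
  obtain ⟨v₁, hv₁, dv₁⟩ := exists_int_near (4 * x.imI.im) b₁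
  obtain ⟨u₂, hu₂, du₂⟩ := exists_int_near (2 * (x.imJ.re + x.imJ.im)) a₂
  obtain ⟨v₂, hv₂, dv₂⟩ := exists_int_near (4 * x.imJ.im) b₂
  obtain ⟨u₃, hu₃, du₃⟩ := exists_int_near (2 * (x.imK.re + x.imK.im)) a₃
  obtain ⟨v₃, hv₃, dv₃⟩ := exists_int_near (4 * x.imK.im) b₃
  have even : ∀ z : ℤ, (z : ZMod 2) = 0 → 2 ∣ z := fun z hz =>
    (ZMod.intCast_zmod_eq_zero_iff_dvd z 2).1 hz
  refine ⟨_, mem_icosian_of_even (u₀ := u₀) (v₀ := v₀) (u₁ := u₁) (v₁ := v₁) (u₂ := u₂) (v₂ := v₂)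
    (u₃ := u₃) (v₃ := v₃) (even _ ?_) (even _ ?_) (even _ ?_) (even _ ?_), ?_⟩
  · push_cast
    rw [hu₁, hu₃, hv₃, hv₂]
    linear_combination e₁
  · push_cast
    rw [hv₁, hv₂, hu₃, hu₂]
    linear_combination e₂
  · push_cast
    rw [hu₀, hu₂, hv₃, hv₂]
    linear_combination e₃
  · push_cast
    rw [hv₀, hu₃, hu₂, hv₃]
    linear_combination e₄
  · generalize hy : x - quat _ _ _ _ = y
    refine (absNorm_le _).trans_lt ?_
    have hw' : (a₀.val + b₀.val + a₁.val + b₁.val + a₂.val + b₂.val + a₃.val + b₃.val : ℚ) ≤ 2 := by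
      exact_mod_cast hw
    have hT : (normSq y).re + (normSq y).im =
        ((2 * (x.re.re + x.re.im) - u₀) ^ 2 + (4 * x.re.im - v₀) ^ 2
        + (2 * (x.imI.re + x.imI.im) - u₁) ^ 2 + (4 * x.imI.im - v₁) ^ 2
        + (2 * (x.imJ.re + x.imJ.im) - u₂) ^ 2 + (4 * x.imJ.im - v₂) ^ 2
        + (2 * (x.imK.re + x.imK.im) - u₃) ^ 2 + (4 * x.imK.im - v₃) ^ 2) / 4 := by
      rw [← hy]
      simp [normSq_def', pow_two]
      ring
    have hT0 : 0 ≤ (normSq y).re + (normSq y).im := by rw [hT]; positivity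
    -- `(8 · 1/4 + 2 · 3/4) / 4 = 7/8`, and `5/4 · (7/8)² = 245/256 < 1`.
    have hT1 : (normSq y).re + (normSq y).im ≤ 7 / 8 := by rw [hT]; linarith
    have hT2 := pow_le_pow_left₀ hT0 hT1 2
    linarith

/-- The quotient is an icosian close to `g⁻¹ y`; multiplicativity of the norm scales the error by
`absNorm g`. -/
theorem exists_quotient {g : ℍ[K]} (hg : g ≠ 0) (y : ℍ[K]) :
    ∃ i ∈ 𝕀, absNorm (y - g * i) < absNorm g := by
  have hN : absNorm g ≠ 0 := absNorm_eq_zero_iff.not.2 hg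
  set β : K := (absNorm g)⁻¹ • conj (normSq g) with hβ
  have h1 : β * normSq g = 1 := by
    have h2 : normSq g * conj (normSq g) = algebraMap ℚ K (absNorm g) := by
      rw [absNorm, QuadraticAlgebra.algebraMap_norm_eq_mul_star]
      congr 1
      ext <;> simp
    rw [hβ, smul_mul_assoc, mul_comm, h2, Algebra.smul_def, ← map_mul, inv_mul_cancel₀ hN, map_one]
  set z : ℍ[K] := (β : ℍ[K]) * (star g * y) with hz
  have hgz : g * z = y := by
    rw [hz, ← mul_assoc, ← coe_commutes, mul_assoc, ← mul_assoc g, self_mul_star, ← mul_assoc,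
      ← coe_mul, h1, coe_one, one_mul]
  obtain ⟨i, hi, h⟩ := exists_icosian_near z
  refine ⟨i, hi, ?_⟩
  rw [← hgz, ← mul_sub, absNorm_mul]
  have hpos : 0 < absNorm g := lt_of_le_of_ne (absNorm_nonneg g) hN.symm
  nlinarith

/-- Two icosians, not both zero, have a left common divisor that is a right linear combination of
them. -/
theorem exists_bezout {a b : ℍ[K]} (ha : a ∈ 𝕀) (hb : b ∈ 𝕀) (ha0 : a ≠ 0) :
    ∃ u ∈ 𝕀, ∃ v ∈ 𝕀, LeftDvd (a * u + b * v) a ∧ LeftDvd (a * u + b * v) b := by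
  classical
  have hex : ∃ k : ℕ, ∃ u ∈ 𝕀, ∃ v ∈ 𝕀, a * u + b * v ≠ 0 ∧ absNorm (a * u + b * v) = k := by
    obtain ⟨k, hk⟩ := exists_absNorm_eq_natCast ha
    exact ⟨k, 1, one_mem_icosian, 0, zero_mem _, by simpa using ha0, by simpa using hk⟩
  -- A nonzero element of least norm in `a𝕀 + b𝕀`; a nonzero remainder on division by it would lie
  -- in the same ideal with smaller norm.
  obtain ⟨u, hu, v, hv, h0, hk⟩ := Nat.find_spec hex
  refine ⟨u, hu, v, hv, ?_⟩
  have key : ∀ s ∈ 𝕀, ∀ t ∈ 𝕀, LeftDvd (a * u + b * v) (a * s + b * t) := by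
    intro s hs t ht
    obtain ⟨i, hi, hlt⟩ := exists_quotient h0 (a * s + b * t)
    refine ⟨i, hi, ?_⟩
    by_contra hne
    have hs' : s - u * i ∈ 𝕀 := sub_mem hs (mul_mem_icosian hu hi)
    have ht' : t - v * i ∈ 𝕀 := sub_mem ht (mul_mem_icosian hv hi)
    have e : a * s + b * t - (a * u + b * v) * i = a * (s - u * i) + b * (t - v * i) := by
      rw [mul_sub, mul_sub, add_mul, mul_assoc, mul_assoc]
      abel
    obtain ⟨k, hk'⟩ := exists_absNorm_eq_natCast
      (add_mem (mul_mem_icosian ha hs') (mul_mem_icosian hb ht'))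
    rw [e, hk', hk] at hlt
    exact Nat.find_min hex (by exact_mod_cast hlt)
      ⟨_, hs', _, ht', by rw [← e]; exact sub_ne_zero.2 hne, hk'⟩
  have h1 := key 1 one_mem_icosian 0 (zero_mem _)
  have h2 := key 0 (zero_mem _) 1 one_mem_icosian
  rw [mul_one, mul_zero, add_zero] at h1
  rw [mul_one, mul_zero, zero_add] at h2
  exact ⟨h1, h2⟩


/-! ### Real embedding and the lattice as twist-fixed icosians -/

section components

variable (q : ℍ[K])

theorem re_toRealQuat : (toRealQuat q).re = toReal q.re := rfl

theorem imI_toRealQuat : (toRealQuat q).imI = toReal q.imI := rfl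

theorem imJ_toRealQuat : (toRealQuat q).imJ = toReal q.imJ := rfl

theorem imK_toRealQuat : (toRealQuat q).imK = toReal q.imK := rfl

end components

/-- The inclusion of `ℍ(K)` into the real quaternions as a ring homomorphism. -/
def toRealQuatHom : ℍ[K] →+* ℍ[ℝ] where
  toFun := toRealQuat
  map_zero' := by ext <;> exact map_zero toReal
  map_one' := by ext <;> first | exact map_one toReal | exact map_zero toReal
  map_add' x y := by ext <;> exact map_add toReal _ _
  map_mul' x y := by
    ext <;> simp only [re_toRealQuat, imI_toRealQuat, imJ_toRealQuat, imK_toRealQuat,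
      Quaternion.re_mul, imI_mul, imJ_mul, imK_mul, map_add, map_sub, map_mul]

theorem toRealQuatHom_apply (x : ℍ[K]) : toRealQuatHom x = toRealQuat x := rfl

theorem toRealQuatHom_injective : Function.Injective toRealQuatHom := by
  intro x y h
  exact QuaternionAlgebra.ext (toReal_injective (congrArg (·.re) h))
    (toReal_injective (congrArg (·.imI) h))
    (toReal_injective (congrArg (·.imJ) h)) (toReal_injective (congrArg (·.imK) h))

theorem len_sq (x : ℍ[K]) : len x ^ 2 = toReal (normSq x) := by
  rw [len, pow_two, ← normSq_eq_norm_mul_self, normSq_def', normSq_def']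
  simp only [map_add, map_pow]
  rfl

theorem toReal_τ : toReal τ = Real.goldenRatio := by
  rw [toReal_apply, Real.goldenRatio]
  simp
  ring

theorem L_eq_closure : L = AddSubgroup.closure
    {toRealQuatHom (ofCoords 1 0 0 0), toRealQuatHom (ofCoords (-1) 0 1 0),
      toRealQuatHom (ofCoords 0 (-1) 0 0),
      toRealQuatHom (ofCoords (-1) 2 (τ - 1) (1 - 2 * τ))} := by
  have e₁ : toRealQuatHom (ofCoords 1 0 0 0) = ⟨1, 0, 0, 0⟩ := by
    ext <;> simp [toRealQuatHom_apply, toRealQuat]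
  have e₂ : toRealQuatHom (ofCoords (-1) 0 1 0) = (1 / 2 : ℝ) • (⟨-1, 1, 1, 1⟩ : ℍ[ℝ]) := by
    refine QuaternionAlgebra.ext ?_ ?_ ?_ ?_
    · change toReal _ = (1 / 2 : ℝ) * -1
      simp [toReal_apply]
      norm_num
    all_goals
      change toReal _ = (1 / 2 : ℝ) * 1
      simp [toReal_apply]
  have e₃ : toRealQuatHom (ofCoords 0 (-1) 0 0) = ⟨0, -1, 0, 0⟩ := by
    ext <;> simp [toRealQuatHom_apply, toRealQuat]
  have e₄ : toRealQuatHom (ofCoords (-1) 2 (τ - 1) (1 - 2 * τ)) =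
      (1 / 2 : ℝ) • (⟨0, 1, Real.goldenRatio - 1, -Real.goldenRatio⟩ : ℍ[ℝ]) := by
    rw [← toReal_τ]
    refine QuaternionAlgebra.ext ?_ ?_ ?_ ?_
    · change toReal _ = (1 / 2 : ℝ) * 0
      simp [toReal_apply]
      norm_num
    · change toReal _ = (1 / 2 : ℝ) * 1
      simp [toReal_apply]
      norm_num
    · change toReal _ = (1 / 2 : ℝ) * (toReal τ - 1)
      simp [toReal_apply, Rat.smul_def]
      ring
    · change toReal _ = (1 / 2 : ℝ) * -toReal τ
      simp [toReal_apply, Rat.smul_def]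
      ring
  rw [e₁, e₂, e₃, e₄]
  rfl

/-- The lattice `L` consists of the icosians fixed by the twist map. -/
theorem mem_L_iff {y : ℍ[ℝ]} : y ∈ L ↔ ∃ x ∈ 𝕀, twist x = x ∧ toRealQuatHom x = y := by
  rw [L_eq_closure]
  constructor
  · intro h
    induction h using AddSubgroup.closure_induction with
    | mem y hy =>
      rcases hy with rfl | rfl | rfl | rfl
      · exact ⟨_, mem_icosian_iff.2 ⟨1, 0, 0, 0, rfl⟩, by ext <;> simp, rfl⟩
      · exact ⟨_, mem_icosian_iff.2 ⟨-1, 0, 1, 0, rfl⟩, by ext <;> simp, rfl⟩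
      · exact ⟨_, mem_icosian_iff.2 ⟨0, -1, 0, 0, rfl⟩, by ext <;> simp, rfl⟩
      · exact ⟨ofCoords (-1) 2 (τ - 1) (1 - 2 * τ),
          mem_icosian_iff.2 ⟨-1, 2, τₒ - 1, 1 - 2 * τₒ, rfl⟩, by ext <;> simp <;> norm_num, rfl⟩
    | zero => exact ⟨0, zero_mem _, by simpa using twist_natCast 0, map_zero _⟩
    | add y z _ _ hy hz =>
      obtain ⟨x, hx, tx, rfl⟩ := hy
      obtain ⟨w, hw, tw, rfl⟩ := hz
      exact ⟨x + w, add_mem hx hw, by rw [twist_add, tx, tw], map_add _ _ _⟩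
    | neg y _ hy =>
      obtain ⟨x, hx, tx, rfl⟩ := hy
      refine ⟨-x, neg_mem hx, ?_, map_neg _ _⟩
      conv_rhs => rw [← tx]
      ext <;> simp
  · rintro ⟨x, hx, tx, rfl⟩
    obtain ⟨⟨_, a, a', rfl⟩, ⟨_, b, b', rfl⟩, ⟨_, c, c', rfl⟩, ⟨_, d, d', rfl⟩, rfl⟩ :=
      mem_icosian_iff.1 hx
    have h₁ := congrArg (fun q => q.re.im) tx
    have h₂ := congrArg (fun q => q.imI.im) tx
    have h₃ := congrArg (fun q => q.imJ.re) tx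
    have h₄ := congrArg (fun q => q.imJ.im) tx
    simp at h₁ h₂ h₃ h₄
    -- Being fixed leaves only the four integers `a, b, c, c'` free, matching the rank of `L`.
    have hd : (d' : ℚ) = -2 * c' := by linarith
    have hd' : (d : ℚ) = c' := by linarith
    have ha : (a' : ℚ) = 0 := by linarith
    have hb : (b' : ℚ) = 0 := by linarith
    have key : ofCoords (a + a' * τ) (b + b' * τ) (c + c' * τ) (d + d' * τ) =
        (a + c + c' + c') • ofCoords 1 0 0 0 + (c + c') • ofCoords (-1) 0 1 0
          + (c' + c' - b) • ofCoords 0 (-1) 0 0 + c' • ofCoords (-1) 2 (τ - 1) (1 - 2 * τ) := by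
      ext <;> simp [ha, hb, hd, hd'] <;> ring
    have mem := fun v hv => AddSubgroup.subset_closure (G := ℍ[ℝ]) (k :=
      {toRealQuatHom (ofCoords 1 0 0 0), toRealQuatHom (ofCoords (-1) 0 1 0),
      toRealQuatHom (ofCoords 0 (-1) 0 0),
      toRealQuatHom (ofCoords (-1) 2 (τ - 1) (1 - 2 * τ))}) (a := v) hv
    change toRealQuatHom (ofCoords (a + a' * τ) (b + b' * τ) (c + c' * τ) (d + d' * τ)) ∈ _
    rw [key]
    simp only [map_add, map_zsmul]
    refine add_mem (add_mem (add_mem ?_ ?_) ?_) ?_ <;>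
      exact zsmul_mem (mem _ (by simp)) _

/-! ### Coincidence site lattices as divisibility conditions -/

theorem normSq_mul_normSq_twist {p : ℍ[K]} {n : ℕ} (hn : (n : ℝ) = len (p * twist p)) :
    normSq p * normSq (twist p) = (n : K) ^ 2 := by
  apply toReal_injective
  rw [← map_mul, ← len_sq, ← hn, map_pow, map_natCast]

theorem R_toRealQuatHom {p : ℍ[K]} {n : ℕ} (hn : (n : ℝ) = len (p * twist p)) (hn0 : n ≠ 0)
    (x y : ℍ[K]) :
    R p (toRealQuatHom x) = toRealQuatHom y ↔ p * x * twist p = (n : ℍ[K]) * y := by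
  have h0 : (n : ℝ) ≠ 0 := by exact_mod_cast hn0
  have h1 : R p (toRealQuatHom x) = (n : ℝ)⁻¹ • toRealQuatHom (p * x * twist p) := by
    rw [hn, map_mul, map_mul, mul_assoc]
    rfl
  have h2 : (n : ℝ) • toRealQuatHom y = toRealQuatHom ((n : ℍ[K]) * y) := by
    rw [map_mul, map_natCast, Nat.cast_smul_eq_nsmul, nsmul_eq_mul]
  rw [h1, inv_smul_eq_iff₀ h0, h2, toRealQuatHom_injective.eq_iff]

theorem natCast_mul_left_cancel {n : ℕ} (hn0 : n ≠ 0) {x y : ℍ[K]}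
    (h : (n : ℍ[K]) * x = (n : ℍ[K]) * y) : x = y := by
  have h0 : (n : ℍ[ℝ]) ≠ 0 := fun h => hn0 (by simpa using congrArg (fun q => q.re) h)
  apply toRealQuatHom_injective
  have h' := congrArg toRealQuatHom h
  rw [map_mul, map_mul, map_natCast] at h'
  exact mul_left_cancel₀ h0 h'

/-- The maps for `p` and `star p` are mutually inverse: composing them produces the central factor
`normSq p * normSq (twist p) = n²`. -/
theorem mul_mul_twist_eq_iff {p : ℍ[K]} {n : ℕ} (hn : (n : ℝ) = len (p * twist p)) (hn0 : n ≠ 0)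
    (x y : ℍ[K]) :
    p * x * twist p = (n : ℍ[K]) * y ↔ star p * y * twist (star p) = (n : ℍ[K]) * x := by
  have hN := normSq_mul_normSq_twist hn
  have hN' : ((normSq p * normSq (twist p) : K) : ℍ[K]) = (n : ℍ[K]) * n := by
    rw [hN, pow_two, coe_mul, coe_natCast]
  have comm : ∀ z : ℍ[K], (n : ℍ[K]) * z = z * n := fun z => Nat.cast_commute n z
  constructor
  · intro h
    apply natCast_mul_left_cancel hn0
    calc (n : ℍ[K]) * (star p * y * twist (star p))
        = star p * ((n : ℍ[K]) * y) * twist (star p) := by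
          rw [← mul_assoc, ← mul_assoc, comm, mul_assoc (star p)]
      _ = (star p * p) * x * (twist p * star (twist p)) := by
          rw [← h, twist_star]
          simp only [mul_assoc]
      _ = (n : ℍ[K]) * ((n : ℍ[K]) * x) := by
          rw [star_mul_self, self_mul_star, ← mul_assoc, ← hN', mul_assoc, ← coe_commutes,
            ← mul_assoc, coe_mul]
  · intro h
    apply natCast_mul_left_cancel hn0
    calc (n : ℍ[K]) * (p * x * twist p)
        = p * ((n : ℍ[K]) * x) * twist p := by
          rw [← mul_assoc, ← mul_assoc, comm, mul_assoc p]
      _ = (p * star p) * y * (star (twist p) * twist p) := by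
          rw [← h, twist_star]
          simp only [mul_assoc]
      _ = (n : ℍ[K]) * ((n : ℍ[K]) * y) := by
          rw [star_mul_self, self_mul_star, ← mul_assoc, ← hN', mul_assoc, ← coe_commutes,
            ← mul_assoc, coe_mul]

theorem mem_csl_iff {p : ℍ[K]} {n : ℕ} (hn : (n : ℝ) = len (p * twist p)) (hn0 : n ≠ 0)
    (y : ℍ[ℝ]) :
    y ∈ csl p ↔ ∃ z ∈ 𝕀, twist z = z ∧ toRealQuatHom z = y ∧
      LeftDvd (n : ℍ[K]) (star p * z * twist (star p)) := by
  rw [csl, AddSubgroup.mem_inf, AddSubgroup.mem_map]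
  constructor
  · rintro ⟨hy, x, hx, hxy⟩
    obtain ⟨z, hz, tz, rfl⟩ := mem_L_iff.1 hy
    obtain ⟨w, hw, -, rfl⟩ := mem_L_iff.1 hx
    exact ⟨z, hz, tz, rfl, w, hw,
      (mul_mul_twist_eq_iff hn hn0 w z).1 ((R_toRealQuatHom hn hn0 w z).1 hxy)⟩
  · rintro ⟨z, hz, tz, rfl, w, hw, h⟩
    refine ⟨mem_L_iff.2 ⟨z, hz, tz, rfl⟩, toRealQuatHom w, mem_L_iff.2 ⟨w, hw, ?_, rfl⟩,
      (R_toRealQuatHom hn hn0 w z).2 ((mul_mul_twist_eq_iff hn hn0 w z).2 h)⟩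
    -- The preimage `w` is automatically fixed: twisting `star p * z * twist (star p)` returns it,
    -- since `z` is fixed and products are reversed.
    apply natCast_mul_left_cancel hn0
    have h' := congrArg twist h
    rw [twist_mul, twist_mul, twist_twist, tz, twist_mul, twist_natCast, ← mul_assoc, h] at h'
    rw [h', Nat.cast_commute]

theorem star_add_quat (x y : ℍ[K]) : star (x + y) = star x + star y := by
  ext <;> simp <;> ring

theorem LeftDvd.mul_mul {n : ℕ} {x : ℍ[K]} (h : LeftDvd (n : ℍ[K]) x) {r s : ℍ[K]} (hr : r ∈ 𝕀)
    (hs : s ∈ 𝕀) : LeftDvd (n : ℍ[K]) (r * x * s) := by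
  obtain ⟨y, hy, rfl⟩ := h
  refine ⟨r * y * s, mul_mem_icosian (mul_mem_icosian hr hy) hs, ?_⟩
  rw [← mul_assoc, ← (Nat.cast_commute n r).eq]
  simp only [mul_assoc]

/-- If `g` generates the right ideal spanned by `p` and `n`, then `p` may be replaced by `g` in
the divisibility condition that describes the coincidence site lattice. -/
theorem leftDvd_star_mul_twist_iff {p g u v : ℍ[K]} {n : ℕ} (hu : u ∈ 𝕀) (hv : v ∈ 𝕀)
    (hp : p ∈ 𝕀) (hg : g = p * u + n * v) (hgp : LeftDvd g p) {z : ℍ[K]} (hz : z ∈ 𝕀) :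
    LeftDvd (n : ℍ[K]) (star p * z * twist (star p)) ↔
      LeftDvd (n : ℍ[K]) (star g * z * twist (star g)) := by
  constructor
  · intro h
    have hu' := star_mem_icosian hu
    have hv' := star_mem_icosian hv
    have hp' := star_mem_icosian hp
    obtain ⟨w, hw, e⟩ := h.mul_mul hu' (twist_mem_icosian hu')
    -- In the expansion with `star g = star u * star p + n * star v`, the first term is `n * w` and
    -- every other term carries an explicit factor `n`.
    refine ⟨w + star u * star p * z * twist (star v) + star v * z * twist (star p) * twist (star u)
      + n * (star v * z * twist (star v)), ?_, ?_⟩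
    · refine add_mem (add_mem (add_mem hw ?_) ?_) ?_
      · exact mul_mem_icosian (mul_mem_icosian (mul_mem_icosian hu' hp') hz) (twist_mem_icosian hv')
      · exact mul_mem_icosian (mul_mem_icosian (mul_mem_icosian hv' hz) (twist_mem_icosian hp'))
          (twist_mem_icosian hu')
      · exact mul_mem_icosian (natCast_mem_icosian n)
          (mul_mem_icosian (mul_mem_icosian hv' hz) (twist_mem_icosian hv'))
    · have hsg : star g = star u * star p + n * star v := by
        rw [hg, star_add_quat, star_mul, star_mul, star_natCast, Nat.cast_commute]
      have htg : twist (star g) = twist (star p) * twist (star u) + n * twist (star v) := by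
        rw [hsg, twist_add, twist_mul, twist_mul, twist_natCast, Nat.cast_commute]
      have comm : ∀ a b : ℍ[K], a * ((n : ℍ[K]) * b) = n * (a * b) := fun a b => by
        rw [← mul_assoc, ← (Nat.cast_commute n a).eq, mul_assoc]
      rw [htg, hsg]
      simp only [mul_assoc] at e
      simp only [add_mul, mul_add, mul_assoc, comm, e]
      abel
  · rintro h
    -- Conversely `p = g * r`, so the expression for `p` is that for `g` multiplied on both sides by
    -- icosians.
    obtain ⟨r, hr, rfl⟩ := hgp
    have := h.mul_mul (star_mem_icosian hr) (twist_mem_icosian (star_mem_icosian hr))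
    rw [star_mul, twist_mul]
    simpa only [mul_assoc] using this

/-! ### Greatest common divisors and the conclusion -/

/-- Icosians `a ≠ 0` and `b` have a greatest left common divisor. -/
theorem glcd_nonempty {a b : ℍ[K]} (ha : a ∈ 𝕀) (hb : b ∈ 𝕀) (ha0 : a ≠ 0) :
    (glcd a b).Nonempty := by
  obtain ⟨u, hu, v, hv, h₁, h₂⟩ := exists_bezout ha hb ha0
  refine ⟨_, add_mem (mul_mem_icosian ha hu) (mul_mem_icosian hb hv), h₁, h₂, ?_⟩
  rintro c - ⟨x, hx, rfl⟩ ⟨y, hy, rfl⟩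
  exact ⟨x * u + y * v, add_mem (mul_mem_icosian hx hu) (mul_mem_icosian hy hv), by
    rw [mul_add, mul_assoc, mul_assoc]⟩

/-- Every greatest left common divisor is a right linear combination. -/
theorem exists_eq_of_mem_glcd {a b g : ℍ[K]} (ha : a ∈ 𝕀) (hb : b ∈ 𝕀) (ha0 : a ≠ 0)
    (hg : g ∈ glcd a b) : ∃ u ∈ 𝕀, ∃ v ∈ 𝕀, g = a * u + b * v := by
  obtain ⟨u, hu, v, hv, h₁, h₂⟩ := exists_bezout ha hb ha0
  obtain ⟨w, hw, h⟩ := hg.2.2.2 _ (add_mem (mul_mem_icosian ha hu) (mul_mem_icosian hb hv)) h₁ h₂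
  exact ⟨u * w, mul_mem_icosian hu hw, v * w, mul_mem_icosian hv hw, by
    rw [h, add_mul, mul_assoc, mul_assoc]⟩

theorem IsPrimitive.ne_zero {p : ℍ[K]} (hp : IsPrimitive p) : p ≠ 0 := by
  rintro rfl
  -- Zero is not primitive: `½ · 0` is an icosian, but `½ ∉ ℤ[τ]`.
  obtain ⟨m, n, h⟩ := hp.2 ⟨1 / 2, 0⟩ (by
    convert zero_mem 𝕀
    ext <;> simp)
  have h₁ := congrArg (fun q => q.re) h
  have h₂ := congrArg (fun q => q.im) h
  simp at h₁ h₂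
  rw [h₂] at h₁
  have h₃ : (2 * m : ℚ) = 1 := by
    push_cast at h₁
    linarith
  have h₄ : 2 * m = 1 := by exact_mod_cast h₃
  omega

theorem ne_zero_of_eq_len {p : ℍ[K]} (hp : p ≠ 0) {n : ℕ} (hn : (n : ℝ) = len (p * twist p)) :
    n ≠ 0 := by
  rintro rfl
  have h := normSq_mul_normSq_twist hn
  rw [← map_mul, Nat.cast_zero, zero_pow two_ne_zero, normSq_eq_zero_iff] at h
  have h' := congrArg absNorm h
  rw [absNorm_mul, absNorm_eq_zero_iff.2 rfl, mul_eq_zero, absNorm_eq_zero_iff,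
    absNorm_eq_zero_iff, twist_eq_zero_iff, or_self] at h'
  exact hp h'

theorem natCast_eq_of_len_eq {p₁ p₂ : ℍ[K]} {n₁ n₂ : ℕ} (hn₁ : (n₁ : ℝ) = len (p₁ * twist p₁))
    (hn₂ : (n₂ : ℝ) = len (p₂ * twist p₂)) (hnorm : len p₁ ^ 2 = len p₂ ^ 2) : n₁ = n₂ := by
  have h : normSq p₁ = normSq p₂ := toReal_injective (by rw [← len_sq, ← len_sq, hnorm])
  have h' : (n₁ : K) ^ 2 = (n₂ : K) ^ 2 := by
    rw [← normSq_mul_normSq_twist hn₁, ← normSq_mul_normSq_twist hn₂, ← conj_normSq, ← conj_normSq,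
      h]
  have h'' := congrArg toReal h'
  simp only [map_pow, map_natCast] at h''
  exact Nat.pow_left_injective two_ne_zero (by exact_mod_cast h'')

end Icosian

end

theorem lemma3 (p₁ p₂ : ℍ[Icosian.K])
    (hprim₁ : Icosian.IsPrimitive p₁) (hadm₁ : Icosian.IsAdmissible p₁)
    (hprim₂ : Icosian.IsPrimitive p₂) (hadm₂ : Icosian.IsAdmissible p₂)
    (n₁ n₂ : ℕ)
    (hn₁ : (n₁ : ℝ) = Icosian.len (p₁ * Icosian.twist p₁))
    (hn₂ : (n₂ : ℝ) = Icosian.len (p₂ * Icosian.twist p₂))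
    (hnorm : Icosian.len p₁ ^ 2 = Icosian.len p₂ ^ 2)
    (hglcd : Icosian.glcd p₁ (n₁ : ℍ[Icosian.K]) = Icosian.glcd p₂ (n₂ : ℍ[Icosian.K])) :
    Icosian.csl p₁ = Icosian.csl p₂ := by
  open Icosian in
  obtain rfl := natCast_eq_of_len_eq hn₁ hn₂ hnorm
  have hn0 := ne_zero_of_eq_len hprim₁.ne_zero hn₁
  have hI := natCast_mem_icosian n₁
  -- Equality of the glcd classes is usable only because they are nonempty; one `g` then serves both
  -- `p₁` and `p₂`.
  obtain ⟨g, hg₁⟩ := glcd_nonempty hprim₁.1 hI hprim₁.ne_zero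
  have hg₂ := hglcd ▸ hg₁
  obtain ⟨u₁, hu₁, v₁, hv₁, e₁⟩ := exists_eq_of_mem_glcd hprim₁.1 hI hprim₁.ne_zero hg₁
  obtain ⟨u₂, hu₂, v₂, hv₂, e₂⟩ := exists_eq_of_mem_glcd hprim₂.1 hI hprim₂.ne_zero hg₂
  ext y
  rw [mem_csl_iff hn₁ hn0, mem_csl_iff hn₂ hn0]
  refine exists_congr fun z => and_congr_right fun hz => and_congr_right fun _ =>
    and_congr_right fun _ => ?_
  rw [leftDvd_star_mul_twist_iff hu₁ hv₁ hprim₁.1 e₁ hg₁.2.1 hz,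
    leftDvd_star_mul_twist_iff hu₂ hv₂ hprim₂.1 e₂ hg₂.2.1 hz]
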